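/- **Notation.** Write $z=(x,t)\in\mathbb R^2\times\mathbb R$, $\mathbf e_2=(0,1)$, and let $|\cdot|$ be the Euclidean length. Fix $0<\varepsilon_0<1$ and a real phase $\phi(z,\eta)$, smooth for $z\in B(0,\varepsilon_0)\subset\mathbb R^3$ and $\eta$ in the open cone generated by $B(\mathbf e_2,\varepsilon_0)\subset\mathbb R^2$, homogeneous of degree $1$ in $\eta$, such that for each $z\in B(0,\varepsilon_0)$ the map $\Upsilon_z:\eta\mapsto\partial_x\phi(z,\eta)$ is injective with invertible differential on $B(\mathbf e_2,\varepsilon_0)$; let $\Psi_z$ be its inverse, defined on $\Upsilon_z(B(\mathbf e_2,\varepsilon_0))$. Let $a_2\in C_c^\infty(B(\mathbf e_2,\varepsilon_0))$, and let $\rho\in C_c^\infty(\mathbb R^2)$ satisfy $\sum_{j\in\mathbb Z^2}\rho(\eta-j)\equiv1$. For $\lambda\ge1$ put $\phi^\lambda(z,\eta)=\lambda\phi(z/\lambda,\eta)$ and $\Psi^\lambda(z,\eta)=\Psi_{z/\lambda}(\eta)$. Let $\{\chi_\nu\}_{0\le\nu\le n}$, with $K^{-1}\lambda^{1/2}\le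 n\le K\lambda^{1/2}$, be functions on $\mathbb R^2\setminus0$ that are smooth, homogeneous of degree $0$, satisfy $\sum_\nu\chi_\nu\equiv1$ and $|\partial^\alpha\chi_\nu|\le C_{|\alpha|}\lambda^{|\alpha|/2}$ on the unit circle, and are such that for $\nu\ge1$ the function $\chi_\nu$ is supported where $\bigl|\eta/|\eta|-\kappa_\nu\bigr|\le K\lambda^{-1/2}$ for some unit vector $\kappa_\nu$. Let $\varepsilon>0$. For $\bar z$ with $\bar z/\lambda\in B(0,\varepsilon_0)$ (for example the centre $z_k$ of a cube $Q_k$ of side $\lambda^{1/2-\varepsilon}$), put $$h_{\bar z}(\eta)=(\partial_t\phi^\lambda)(\bar z,\Psi^\lambda(\bar z,\eta)),\qquad a^\nu_{2,\bar z}(\eta)=(\chi_\nu a_2)(\Psi^\lambda(\bar z,\eta))\,|\det\partial_\eta\Psi^\lambda(\bar z,\eta)|$$ (extended by $0$ off the domain of $\Psi^\lambda(\bar z,\cdot)$), and $$E^\nu_{\bar z}g(z)=\int_{\mathbb R^2}e^{i(\langle x,\eta\rangle+th_{\bar z}(\eta))}a^\nu_{2,\bar z}(\eta)g(\eta)\,d\eta,$$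 $$E^{\nu,j}_{\bar z}g(z)=\int_{\mathbb R^2}e^{i(\langle x,\eta\rangle+th_{\bar z}(\eta))}\rho(\lambda^{1/2-\varepsilon/2}\eta-j)\,a^\nu_{2,\bar z}(\eta)g(\eta)\,d\eta .$$ Let $N\in\mathbb N$, $A\ge1$, and let $w_{Q_0}$ be any measurable weight adapted to the cube $Q_0$ of side $\lambda^{1/2-\varepsilon}$ centred at the origin, in the sense that $$A^{-1}\Bigl(1+\frac{|z|}{\lambda^{1/2-\varepsilon}}\Bigr)^{-N}\le w_{Q_0}(z)\le A\Bigl(1+\frac{|z|}{\lambda^{1/2-\varepsilon}}\Bigr)^{-N}.$$ **Lemma.** There are a constant $C$ and a function $\mathrm{RapDec}:[1,\infty)\to[0,\infty)$ with $\mathrm{RapDec}(\lambda)=O_M(\lambda^{-M})$ for every $M$, depending only on $\varepsilon_0,\phi,a_2,\rho,K,(C_m)_m,N,A,\varepsilon$, such that for all $\lambda\ge1$, all $\{\chi_\nu\}$, $\bar z$, $w_{Q_0}$ as above and all $g\in L^{10/3}(\mathbb R^2)$, $$\Bigl\|\Bigl(\sum_{\nu}\sum_{j\in\mathbb Z^2}|E^{\nu,j}_{\bar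 z}g|^2\Bigr)^{1/2}\Bigr\|_{L^{10/3}(w_{Q_0})}\le C\lambda^{\frac{3N}{20}\varepsilon}\Bigl\|\Bigl(\sum_{\nu}|E^{\nu}_{\bar z}g|^2\Bigr)^{1/2}\Bigr\|_{L^{10/3}(w_{Q_0})}+\mathrm{RapDec}(\lambda)\|g\|_{L^{10/3}(\mathbb R^2)} .$$ In particular, for fixed $N$ the loss is $\lambda^{O_N(\varepsilon)}$, hence at most $\lambda^\delta$ for any prescribed $\delta>0$ once $\varepsilon$ is small. -/

import Mathlib

open MeasureTheory Set
open scoped ENNReal ContDiff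

noncomputable section

namespace RadialBlocks

/-- The plane `ℝ²` with its Euclidean norm. -/
abbrev Plane : Type := EuclideanSpace ℝ (Fin 2)

/-- Space-time `ℝ^{2+1}`, with points `z = (x, t)` and Lebesgue measure. The Euclidean length of
a point is `stNorm`, not the (supremum) norm of the product type. -/
abbrev SpaceTime : Type := Plane × ℝ

/-- The Euclidean length `|z| = (|x|² + t²)^{1/2}` of `z = (x, t)`. -/
def stNorm (z : SpaceTime) : ℝ := Real.sqrt (‖z.1‖ ^ 2 + z.2 ^ 2)

/-- The open Euclidean ball `B(0, r)` in `ℝ^{2+1}`. -/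
def stBall (r : ℝ) : Set SpaceTime := {z | stNorm z < r}

/-- The unit vector `e₂ = (0, 1)`. -/
def e₂ : Plane := !₂[0, 1]

/-- The open cone `{s η : s > 0, η ∈ B(e₂, ε₀)}`. -/
def coneOver (ε₀ : ℝ) : Set Plane :=
  {ξ | ∃ s : ℝ, 0 < s ∧ ∃ η ∈ Metric.ball e₂ ε₀, ξ = s • η}

/-! ### The phase -/

/-- `∂ₓ φ(z, η)`. -/
def gradX (φ : SpaceTime → Plane → ℝ) (z : SpaceTime) (η : Plane) : Plane :=
  gradient (fun x : Plane => φ (x, z.2) η) z.1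

/-- `∂ₜ φ(z, η)`. -/
def derivT (φ : SpaceTime → Plane → ℝ) (z : SpaceTime) (η : Plane) : ℝ :=
  deriv (fun t : ℝ => φ (z.1, t) η) z.2

/-- A smooth phase on `B(0, ε₀) × cone(B(e₂, ε₀))`, homogeneous of degree one in `η`, with `ε₀`
so small that for each `z ∈ B(0, ε₀)` the map `Υ_z : η ↦ ∂ₓφ(z, η)` is a diffeomorphism of
`B(e₂, ε₀)` onto its image. -/
structure IsPhase (φ : SpaceTime → Plane → ℝ) (ε₀ : ℝ) : Prop where
  smooth : ContDiffOn ℝ ∞ (fun p : SpaceTime × Plane => φ p.1 p.2) (stBall ε₀ ×ˢ coneOver ε₀)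
  homogeneous : ∀ z ∈ stBall ε₀, ∀ η ∈ coneOver ε₀, ∀ s : ℝ, 0 < s → φ z (s • η) = s * φ z η
  injOn : ∀ z ∈ stBall ε₀, InjOn (gradX φ z) (Metric.ball e₂ ε₀)
  det_ne_zero : ∀ z ∈ stBall ε₀, ∀ η ∈ Metric.ball e₂ ε₀, (fderiv ℝ (gradX φ z) η).det ≠ 0

/-- The image `Υ_z(B(e₂, ε₀))`, on which the inverse map `Ψ_z` lives. -/
def gradImage (φ : SpaceTime → Plane → ℝ) (ε₀ : ℝ) (z : SpaceTime) : Set Plane :=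
  gradX φ z '' Metric.ball e₂ ε₀

/-- `Ψ_z`, the inverse of `Υ_z = ∂ₓφ(z, ·)` on `B(e₂, ε₀)`; only its values on `gradImage φ ε₀ z`
are meaningful. -/
def psi (φ : SpaceTime → Plane → ℝ) (ε₀ : ℝ) (z : SpaceTime) : Plane → Plane :=
  Function.invFunOn (gradX φ z) (Metric.ball e₂ ε₀)

/-- The rescaled phase `φ^lam(z, η) = lam φ(z / lam, η)`. -/
def phaseScaled (φ : SpaceTime → Plane → ℝ) (lam : ℝ) (z : SpaceTime) (η : Plane) : ℝ :=
  lam * φ (lam⁻¹ • z) η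

/-- `Ψ^lam(z, η) = Ψ(z / lam, η)`. -/
def psiScaled (φ : SpaceTime → Plane → ℝ) (ε₀ lam : ℝ) (z : SpaceTime) : Plane → Plane :=
  psi φ ε₀ (lam⁻¹ • z)

/-- `h_z(η) = (∂ₜ φ^lam)(z, Ψ^lam(z, η))`. -/
def hFun (φ : SpaceTime → Plane → ℝ) (ε₀ lam : ℝ) (z : SpaceTime) (η : Plane) : ℝ :=
  derivT (phaseScaled φ lam) z (psiScaled φ ε₀ lam z η)

open Classical in
/-- For an amplitude `b` supported in `B(e₂, ε₀)`, the transported amplitude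
`b_z(η) = b(Ψ^lam(z, η)) |det ∂_η Ψ^lam(z, η)|`, extended by zero off the domain of `Ψ^lam(z, ·)`. -/
def transported (φ : SpaceTime → Plane → ℝ) (ε₀ lam : ℝ) (z : SpaceTime) (b : Plane → ℂ)
    (η : Plane) : ℂ :=
  if η ∈ gradImage φ ε₀ (lam⁻¹ • z) then
    b (psiScaled φ ε₀ lam z η) * ((|(fderiv ℝ (psiScaled φ ε₀ lam z) η).det| : ℝ) : ℂ)
  else 0

/-! ### The angular and the radial decompositions -/

/-- Smooth angular partition of unity at scale `lam^{-1/2}`: functions `χ_ν`, `0 ≤ ν ≤ n` with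
`n ≈ lam^{1/2}`, homogeneous of degree zero, with sum one on `ℝ² ∖ 0`; for `ν ≥ 1` the function
`χ_ν` lives on a sector of aperture `O(lam^{-1/2})` about the direction `κ_ν`, and `χ_0` takes up
what the sectors do not cover. The constants are `K` (for size) and `Cχ m` (for derivatives of
order `m`). -/
structure IsAngularPartition (lam K : ℝ) (Cχ : ℕ → ℝ) (n : ℕ) (κ : Fin (n + 1) → Plane)
    (χ : Fin (n + 1) → Plane → ℝ) : Prop where
  card_lower : K⁻¹ * lam ^ (1 / 2 : ℝ) ≤ n
  card_upper : (n : ℝ) ≤ K * lam ^ (1 / 2 : ℝ)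
  norm_center : ∀ ν, ‖κ ν‖ = 1
  smooth : ∀ ν, ContDiffOn ℝ ∞ (χ ν) {0}ᶜ
  homogeneous : ∀ ν, ∀ η : Plane, η ≠ 0 → ∀ s : ℝ, 0 < s → χ ν (s • η) = χ ν η
  sum_eq_one : ∀ η : Plane, η ≠ 0 → ∑ ν, χ ν η = 1
  support_sector : ∀ ν, ν ≠ 0 → ∀ η : Plane, η ≠ 0 → χ ν η ≠ 0 →
    ‖‖η‖⁻¹ • η - κ ν‖ ≤ K * lam ^ (-(1 / 2) : ℝ)
  deriv_bound : ∀ ν, ∀ m : ℕ, ∀ η : Plane, ‖η‖ = 1 →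
    ‖iteratedFDeriv ℝ m (χ ν) η‖ ≤ Cχ m * lam ^ ((m : ℝ) / 2)

/-- The point of `ℝ²` with integer coordinates `j`. -/
def latticePt (j : Fin 2 → ℤ) : Plane := WithLp.toLp 2 (fun i => (j i : ℝ))

/-- `ρ ∈ C_c^∞(ℝ²)` whose integer translates sum to one. -/
structure IsLatticePartition (ρ : Plane → ℝ) : Prop where
  smooth : ContDiff ℝ ∞ ρ
  compact : HasCompactSupport ρ
  sum_eq_one : ∀ η : Plane, HasSum (fun j : Fin 2 → ℤ => ρ (η - latticePt j)) 1

/-! ### The extension operators -/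

/-- `g ↦ ∫ e^{i(⟨x, η⟩ + t h(η))} b(η) g(η) dη`, evaluated at `z = (x, t)`. -/
def extension (h : Plane → ℝ) (b : Plane → ℂ) (g : Plane → ℂ) (z : SpaceTime) : ℂ :=
  ∫ η : Plane, Complex.exp (Complex.I * ((inner ℝ z.1 η + z.2 * h η : ℝ) : ℂ)) * b η * g η

/-- The amplitude `a_{2,z}^ν`, where `a_2^ν = χ_ν a_2`. -/
def ampAngular (φ : SpaceTime → Plane → ℝ) (ε₀ lam : ℝ) (zc : SpaceTime) (a₂ : Plane → ℂ)
    (χν : Plane → ℝ) : Plane → ℂ :=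
  transported φ ε₀ lam zc (fun η => (χν η : ℂ) * a₂ η)

/-- `E_{zc}^ν g`, one angular piece. -/
def extAngular (φ : SpaceTime → Plane → ℝ) (ε₀ lam : ℝ) (zc : SpaceTime) (a₂ : Plane → ℂ)
    (χν : Plane → ℝ) (g : Plane → ℂ) : SpaceTime → ℂ :=
  extension (hFun φ ε₀ lam zc) (ampAngular φ ε₀ lam zc a₂ χν) g

/-- `E_{zc}^{ν,j} g`, the piece further localized by `ρ(lam^{1/2-ε/2} η - j)`. -/
def extBlock (φ : SpaceTime → Plane → ℝ) (ε₀ lam ε : ℝ) (zc : SpaceTime) (a₂ : Plane → ℂ)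
    (ρ : Plane → ℝ) (χν : Plane → ℝ) (j : Fin 2 → ℤ) (g : Plane → ℂ) : SpaceTime → ℂ :=
  extension (hFun φ ε₀ lam zc)
    (fun η => (ρ (lam ^ (1 / 2 - ε / 2) • η - latticePt j) : ℂ) *
      ampAngular φ ε₀ lam zc a₂ χν η) g

/-! ### Square functions, weights, rapid decay -/

/-- The square function `(∑ᵢ |Fᵢ|²)^{1/2}`, with values in `[0, ∞]`. -/
def squareFun {ι : Type} (F : ι → SpaceTime → ℂ) (z : SpaceTime) : ℝ≥0∞ :=
  (∑' i, ‖F i z‖ₑ ^ 2) ^ (1 / 2 : ℝ)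

/-- `w` is a weight adapted to the ball (or cube) centred at the origin of radius `r`, decaying of
order `N`: up to the factor `A`, it is `(1 + |z| / r)^{-N}`. -/
structure IsAdaptedWeight (w : SpaceTime → ℝ) (r : ℝ) (N : ℕ) (A : ℝ) : Prop where
  measurable : Measurable w
  lower : ∀ z, A⁻¹ * ((1 + stNorm z / r) ^ N)⁻¹ ≤ w z
  upper : ∀ z, w z ≤ A * ((1 + stNorm z / r) ^ N)⁻¹

/-- The norm of `L^{10/3}(w)`, for functions with values in `[0, ∞]`. -/
def weightedNorm (w : SpaceTime → ℝ) (G : SpaceTime → ℝ≥0∞) : ℝ≥0∞ :=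
  (∫⁻ z, G z ^ (10 / 3 : ℝ) * ENNReal.ofReal (w z)) ^ (3 / 10 : ℝ)

/-- `RapDec(lam)`: a nonnegative quantity that is `O(lam^{-M})` on `[1, ∞)` for every `M`. -/
def IsRapDec (q : ℝ → ℝ) : Prop :=
  ∀ M : ℕ, ∃ C : ℝ, ∀ lam : ℝ, 1 ≤ lam → 0 ≤ q lam ∧ q lam ≤ C * lam ^ (-(M : ℝ))

end RadialBlocks

end

/-!
Since `ρ(R η - j)`, with `R = lam ^ (1/2 - ε/2)`, is the translate by `j` of one Schwartz function
of `R η`, passing from `E^ν g` to `E^{ν,j} g` averages translates of `E^ν g` by `(2πR v, 0)`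
against `e^{-2πi⟨v, j⟩} ρ̂(v)`. Thus `E^{ν,j} g(z)` is the value at `j ∈ ℤ²` of the Fourier
transform of one function of `v`. By duality, the orthonormality of the characters on every unit
cell gives a Bessel inequality for these values: `∑ⱼ |E^{ν,j} g(z)|²` is at most an average of
`|E^ν g|²` over the translates, whose kernel has finite moments of every order. Sum over `ν` and
take `L^{5/3}(w)` norms: Hölder's inequality moves the power `5/3` inside the average, and for a
weight adapted to radius `r = lam ^ (1/2 - ε)` such a translation costs the factor
`(R/r)^N (1 + |v|)^N` with `R/r = lam ^ (ε/2)`. The moments absorb the tails completely, so there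
is no remainder.
-/

open Topology Filter
open scoped FourierTransform SchwartzMap

noncomputable section

namespace RadialBlocks

section InverseFunction

variable {𝕂 E F : Type*} [RCLike 𝕂] [NormedAddCommGroup E] [NormedSpace 𝕂 E] [CompleteSpace E]
  [NormedAddCommGroup F] [NormedSpace 𝕂 F] {f : E → F} {U : Set E} {n : WithTop ℕ∞}

lemma isOpen_image_of_isInvertible_fderiv (hU : IsOpen U) (hn : n ≠ 0)
    (hf : ∀ a ∈ U, ContDiffAt 𝕂 n f a) (hf' : ∀ a ∈ U, (fderiv 𝕂 f a).IsInvertible) :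
    IsOpen (f '' U) := by
  rw [isOpen_iff_mem_nhds]
  rintro _ ⟨a, ha, rfl⟩
  obtain ⟨f', hf'⟩ := hf' a ha
  have hs : HasStrictFDerivAt f (f' : E →L[𝕂] F) a := hf' ▸ (hf a ha).hasStrictFDerivAt hn
  rw [← hs.map_nhds_eq_of_equiv]
  exact image_mem_map (hU.mem_nhds ha)

lemma contDiffAt_invFunOn (hU : IsOpen U) (hinj : InjOn f U) (hn : n ≠ 0) {a : E} (ha : a ∈ U)
    (hf : ContDiffAt 𝕂 n f a) (hf' : (fderiv 𝕂 f a).IsInvertible) :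
    ContDiffAt 𝕂 n (Function.invFunOn f U) (f a) := by
  obtain ⟨f', hf'⟩ := hf'
  have hs : HasStrictFDerivAt f (f' : E →L[𝕂] F) a := hf' ▸ hf.hasStrictFDerivAt hn
  refine (hf.to_localInverse hs.hasFDerivAt hn).congr_of_eventuallyEq ?_
  filter_upwards [hs.localInverse_tendsto.eventually (hU.mem_nhds ha),
    hs.eventually_right_inverse] with y hyU hfy
  calc Function.invFunOn f U y = Function.invFunOn f U (f (hs.localInverse f f' a y)) := by rw [hfy]
    _ = hs.localInverse f f' a y := hinj.leftInvOn_invFunOn hyU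

end InverseFunction

lemma isOpen_stBall (r : ℝ) : IsOpen (stBall r) :=
  isOpen_lt (by unfold stNorm; fun_prop) continuous_const

lemma ball_subset_coneOver (ε₀ : ℝ) : Metric.ball e₂ ε₀ ⊆ coneOver ε₀ :=
  fun η hη => ⟨1, one_pos, η, hη, (one_smul ℝ η).symm⟩

lemma zero_notMem_ball {ε₀ : ℝ} (hε₀ : ε₀ ≤ 1) : (0 : Plane) ∉ Metric.ball e₂ ε₀ := by
  simpa [e₂, EuclideanSpace.norm_eq, Fin.sum_univ_two] using hε₀

lemma mem_gradImage_of_transported_ne_zero {φ : SpaceTime → Plane → ℝ} {ε₀ lam : ℝ}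
    {z : SpaceTime} {b : Plane → ℂ} {η : Plane} (h : transported φ ε₀ lam z b η ≠ 0) :
    η ∈ gradImage φ ε₀ (lam⁻¹ • z) :=
  by_contra fun hη => h (if_neg hη)

namespace IsPhase

variable {φ : SpaceTime → Plane → ℝ} {ε₀ lam : ℝ} {z : SpaceTime} {η : Plane} {b : Plane → ℂ}

lemma contDiffAt (hφ : IsPhase φ ε₀) (hz : z ∈ stBall ε₀) (hη : η ∈ Metric.ball e₂ ε₀) :
    ContDiffAt ℝ ∞ (fun p : SpaceTime × Plane => φ p.1 p.2) (z, η) :=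
  hφ.smooth.contDiffAt <| mem_of_superset
    (((isOpen_stBall ε₀).prod Metric.isOpen_ball).mem_nhds ⟨hz, hη⟩)
    (prod_mono_right (ball_subset_coneOver ε₀))

lemma contDiffAt_gradX (hφ : IsPhase φ ε₀) (hz : z ∈ stBall ε₀) (hη : η ∈ Metric.ball e₂ ε₀) :
    ContDiffAt ℝ ∞ (gradX φ z) η := by
  have h : ContDiffAt ℝ ∞ (fun q : Plane × Plane => φ (q.2, z.2) q.1) (η, z.1) :=
    (hφ.contDiffAt hz hη).comp (f := fun q : Plane × Plane => (((q.2, z.2) : SpaceTime), q.1))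
      (η, z.1) (by fun_prop)
  exact (InnerProductSpace.toDual ℝ Plane).symm.contDiff.contDiffAt.comp η
    (ContDiffAt.fderiv (f := fun η x => φ (x, z.2) η) h contDiffAt_const le_rfl)

lemma isInvertible_fderiv_gradX (hφ : IsPhase φ ε₀) (hz : z ∈ stBall ε₀)
    (hη : η ∈ Metric.ball e₂ ε₀) : (fderiv ℝ (gradX φ z) η).IsInvertible :=
  ⟨_, ContinuousLinearMap.coe_toContinuousLinearEquivOfDetNeZero _ (hφ.det_ne_zero z hz η hη)⟩

lemma isOpen_gradImage (hφ : IsPhase φ ε₀) (hz : z ∈ stBall ε₀) : IsOpen (gradImage φ ε₀ z) :=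
  isOpen_image_of_isInvertible_fderiv Metric.isOpen_ball (by simp : (∞ : WithTop ℕ∞) ≠ 0)
    (fun _ => hφ.contDiffAt_gradX hz) fun _ => hφ.isInvertible_fderiv_gradX hz

lemma contDiffAt_psi (hφ : IsPhase φ ε₀) (hz : z ∈ stBall ε₀) (hη : η ∈ gradImage φ ε₀ z) :
    ContDiffAt ℝ ∞ (psi φ ε₀ z) η := by
  obtain ⟨ξ, hξ, rfl⟩ := hη
  exact contDiffAt_invFunOn Metric.isOpen_ball (hφ.injOn z hz) (by simp) hξ
    (hφ.contDiffAt_gradX hz hξ) (hφ.isInvertible_fderiv_gradX hz hξ)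

lemma continuousAt_derivT (hφ : IsPhase φ ε₀) (hz : lam⁻¹ • z ∈ stBall ε₀)
    (hη : η ∈ Metric.ball e₂ ε₀) : ContinuousAt (derivT (phaseScaled φ lam) z) η := by
  have hscale : ContDiffAt ℝ ∞ (fun q : Plane × ℝ => ((lam⁻¹ • (z.1, q.2) : SpaceTime), q.1))
    (η, z.2) := by fun_prop
  have h : ContDiffAt ℝ ∞ (fun q : Plane × ℝ => phaseScaled φ lam (z.1, q.2) q.1) (η, z.2) :=
    contDiffAt_const.mul (ContDiffAt.comp (g := fun p : SpaceTime × Plane => φ p.1 p.2) (η, z.2)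
      (hφ.contDiffAt hz hη) hscale)
  exact (ContDiffAt.fderiv (f := fun η t => phaseScaled φ lam (z.1, t) η) (m := 0) h
    contDiffAt_const (by simp)).continuousAt.clm_apply continuousAt_const

lemma continuousOn_hFun (hφ : IsPhase φ ε₀) (hz : lam⁻¹ • z ∈ stBall ε₀) :
    ContinuousOn (hFun φ ε₀ lam z) (gradImage φ ε₀ (lam⁻¹ • z)) := fun _ hη =>
  ((hφ.continuousAt_derivT hz (Function.invFunOn_mem hη)).comp (f := psiScaled φ ε₀ lam z)
    (hφ.contDiffAt_psi hz hη).continuousAt).continuousWithinAt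

lemma isCompact_image_gradX (hφ : IsPhase φ ε₀) (hz : z ∈ stBall ε₀) {k : Set Plane}
    (hk : IsCompact k) (hkb : k ⊆ Metric.ball e₂ ε₀) : IsCompact (gradX φ z '' k) :=
  hk.image_of_continuousOn fun _ h =>
    (hφ.contDiffAt_gradX hz (hkb h)).continuousAt.continuousWithinAt

lemma support_transported_subset :
    Function.support (transported φ ε₀ lam z b) ⊆ gradX φ (lam⁻¹ • z) '' tsupport b := by
  intro η hη
  simp only [transported, Function.mem_support, ne_eq, ite_eq_right_iff, Classical.not_imp,
    mul_eq_zero, not_or] at hη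
  exact ⟨_, subset_tsupport b hη.2.1, Function.invFunOn_eq hη.1⟩

lemma hasCompactSupport_transported (hφ : IsPhase φ ε₀) (hz : lam⁻¹ • z ∈ stBall ε₀)
    (hb : HasCompactSupport b) (hbs : tsupport b ⊆ Metric.ball e₂ ε₀) :
    HasCompactSupport (transported φ ε₀ lam z b) :=
  .of_support_subset_isCompact (hφ.isCompact_image_gradX hz hb hbs) support_transported_subset

lemma continuousOn_transported (hφ : IsPhase φ ε₀) (hz : lam⁻¹ • z ∈ stBall ε₀)
    (hb : ContinuousOn b (Metric.ball e₂ ε₀)) :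
    ContinuousOn (transported φ ε₀ lam z b) (gradImage φ ε₀ (lam⁻¹ • z)) := by
  have h : ContinuousOn (fun η => b (psiScaled φ ε₀ lam z η) *
      ((|(fderiv ℝ (psiScaled φ ε₀ lam z) η).det| : ℝ) : ℂ)) (gradImage φ ε₀ (lam⁻¹ • z)) := by
    intro η hη
    have hψ : ContDiffAt ℝ ∞ (psiScaled φ ε₀ lam z) η := hφ.contDiffAt_psi hz hη
    have hbψ := (hb.continuousAt (Metric.isOpen_ball.mem_nhds (Function.invFunOn_mem hη))).comp
      (f := psiScaled φ ε₀ lam z) hψ.continuousAt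
    have hdet := ContinuousLinearMap.continuous_det.continuousAt.comp
      (hψ.fderiv_right (m := 0) (by simp)).continuousAt
    exact (hbψ.mul (Complex.continuous_ofReal.continuousAt.comp hdet.abs)).continuousWithinAt
  exact h.congr fun η hη => if_pos hη

lemma continuous_transported (hφ : IsPhase φ ε₀) (hz : lam⁻¹ • z ∈ stBall ε₀)
    (hbc : ContinuousOn b (Metric.ball e₂ ε₀)) (hb : HasCompactSupport b)
    (hbs : tsupport b ⊆ Metric.ball e₂ ε₀) :
    Continuous (transported φ ε₀ lam z b) := by
  refine continuous_of_tsupport fun η hη => ?_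
  have hcpt := hφ.isCompact_image_gradX hz hb hbs
  have hη' : η ∈ gradImage φ ε₀ (lam⁻¹ • z) :=
    image_mono hbs (closure_minimal support_transported_subset hcpt.isClosed hη)
  exact (hφ.continuousOn_transported hz hbc).continuousAt ((hφ.isOpen_gradImage hz).mem_nhds hη')

lemma exists_measurable_eqOn_hFun (hφ : IsPhase φ ε₀) (hz : lam⁻¹ • z ∈ stBall ε₀) :
    ∃ h : Plane → ℝ, Measurable h ∧
      EqOn (hFun φ ε₀ lam z) h (gradImage φ ε₀ (lam⁻¹ • z)) := by
  classical
  exact ⟨_, (hφ.continuousOn_hFun hz).measurable_piecewise (continuousOn_const (c := 0))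
    (hφ.isOpen_gradImage hz).measurableSet, (piecewise_eqOn _ _ _).symm⟩

lemma integrable_ampAngular_mul (hφ : IsPhase φ ε₀) (hz : lam⁻¹ • z ∈ stBall ε₀)
    {a₂ : Plane → ℂ} (ha₂ : Continuous a₂) (ha₂c : HasCompactSupport a₂)
    (ha₂s : tsupport a₂ ⊆ Metric.ball e₂ ε₀) {χ : Plane → ℝ}
    (hχ : ContinuousOn χ (Metric.ball e₂ ε₀)) {g : Plane → ℂ} (hg : LocallyIntegrable g) :
    Integrable fun η => ampAngular φ ε₀ lam z a₂ χ η * g η := by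
  have hcont : ContinuousOn (fun η => (χ η : ℂ) * a₂ η) (Metric.ball e₂ ε₀) :=
    (Complex.continuous_ofReal.comp_continuousOn hχ).mul ha₂.continuousOn
  have hcpt : HasCompactSupport fun η => (χ η : ℂ) * a₂ η := ha₂c.mul_left
  have hsub : tsupport (fun η => (χ η : ℂ) * a₂ η) ⊆ Metric.ball e₂ ε₀ :=
    tsupport_mul_subset_right.trans ha₂s
  exact hg.integrable_smul_left_of_hasCompactSupport (hφ.continuous_transported hz hcont hcpt hsub)
    (hφ.hasCompactSupport_transported hz hcpt hsub)

end IsPhase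

lemma enorm_sq_sum_smul_of_orthonormal {𝕜 ι H : Type*} [RCLike 𝕜] [NormedAddCommGroup H]
    [InnerProductSpace 𝕜 H] {e : ι → H} (he : Orthonormal 𝕜 e) (s : Finset ι) (α : ι → 𝕜) :
    ‖∑ i ∈ s, α i • e i‖ₑ ^ 2 = ∑ i ∈ s, ‖α i‖ₑ ^ 2 := by
  have h : ‖∑ i ∈ s, α i • e i‖ ^ 2 = ∑ i ∈ s, ‖α i‖ ^ 2 := by
    have := he.inner_sum α α s
    simp only [inner_self_eq_norm_sq_to_K, RCLike.conj_mul] at this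
    exact_mod_cast this
  simp only [← ofReal_norm, ← ENNReal.ofReal_pow (norm_nonneg _), h]
  exact ENNReal.ofReal_sum_of_nonneg fun _ _ => by positivity

section CauchySchwarz

variable {X : Type*} [MeasurableSpace X] {μ : Measure X}

lemma sq_lintegral_mul_le {f g W : X → ℝ≥0∞} (hf : AEMeasurable f μ) (hg : AEMeasurable g μ)
    (hW : AEMeasurable W μ) (hW0 : ∀ x, W x ≠ 0) (hWt : ∀ x, W x ≠ ⊤) :
    (∫⁻ x, f x * g x ∂μ) ^ 2 ≤ (∫⁻ x, f x ^ 2 * (W x)⁻¹ ∂μ) * ∫⁻ x, W x * g x ^ 2 ∂μ := by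
  have hsqrt (a : ℝ≥0∞) : (a ^ 2) ^ (1 / 2 : ℝ) = a := by
    rw [← ENNReal.rpow_natCast, ← ENNReal.rpow_mul]; norm_num
  have hfg (x : X) :
      f x * g x = (f x ^ 2 * (W x)⁻¹) ^ (1 / 2 : ℝ) * (W x * g x ^ 2) ^ (1 / 2 : ℝ) := by
    rw [← ENNReal.mul_rpow_of_nonneg _ _ (by norm_num), mul_assoc, ← mul_assoc _ (W x),
      ENNReal.inv_mul_cancel (hW0 x) (hWt x), one_mul, ← mul_pow, hsqrt]
  have h := ENNReal.lintegral_mul_norm_pow_le ((hf.pow_const 2).mul hW.inv)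
    (hW.mul (hg.pow_const 2)) (p := 1 / 2) (q := 1 / 2) (by norm_num) (by norm_num) (by norm_num)
  simp_rw [hfg]
  refine (pow_le_pow_left' h 2).trans_eq ?_
  rw [← ENNReal.mul_rpow_of_nonneg _ _ (by norm_num), ← ENNReal.rpow_natCast, ← ENNReal.rpow_mul]
  norm_num

lemma tsum_enorm_sq_integral_mul_le {ι : Type*} {e : ι → X → ℂ} (he : ∀ i, Measurable (e i))
    {W : X → ℝ≥0∞} (hW : AEMeasurable W μ) (hW0 : ∀ x, W x ≠ 0) (hWt : ∀ x, W x ≠ ⊤) {B : ℝ≥0∞}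
    (hB : ∀ (s : Finset ι) (α : ι → ℂ),
      ∫⁻ x, W x * ‖∑ i ∈ s, α i * e i x‖ₑ ^ 2 ∂μ ≤ B * ∑ i ∈ s, ‖α i‖ₑ ^ 2)
    {p : X → ℂ} (hp : AEMeasurable p μ) (hpe : ∀ i, Integrable (fun x => p x * e i x) μ) :
    ∑' i, ‖∫ x, p x * e i x ∂μ‖ₑ ^ 2 ≤ B * ∫⁻ x, ‖p x‖ₑ ^ 2 * (W x)⁻¹ ∂μ := by
  rw [ENNReal.tsum_eq_iSup_sum]
  refine iSup_le fun s => ?_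
  let c : ι → ℂ := fun i => ∫ x, p x * e i x ∂μ
  let T : X → ℂ := fun x => ∑ i ∈ s, (starRingEnd ℂ) (c i) * e i x
  set S := ∑ i ∈ s, ‖c i‖ₑ ^ 2 with hS
  have hpT : ∫ x, p x * T x ∂μ = ∑ i ∈ s, (starRingEnd ℂ) (c i) * c i := by
    simp only [T, c, Finset.mul_sum, mul_left_comm (p _)]
    rw [integral_finsetSum _ fun i _ => (hpe i).const_mul _]
    simp only [integral_const_mul]
  have hS_le : S ≤ ∫⁻ x, ‖p x‖ₑ * ‖T x‖ₑ ∂μ := by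
    have h : ‖∫ x, p x * T x ∂μ‖ₑ = S := by
      simp only [hpT, RCLike.conj_mul, hS, ← ofReal_norm, ← ENNReal.ofReal_pow (norm_nonneg _)]
      rw [← ENNReal.ofReal_sum_of_nonneg fun _ _ => by positivity]
      norm_cast
      rw [abs_of_nonneg (by positivity)]
    rw [← h]
    simpa only [enorm_mul] using enorm_integral_le_lintegral_enorm fun x => p x * T x
  have hS_sq : S * S ≤ B * (∫⁻ x, ‖p x‖ₑ ^ 2 * (W x)⁻¹ ∂μ) * S := by
    have hT : Measurable T := Finset.measurable_fun_sum _ fun i _ => (he i).const_mul _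
    calc S * S ≤ (∫⁻ x, ‖p x‖ₑ * ‖T x‖ₑ ∂μ) ^ 2 := by rw [← sq]; gcongr
      _ ≤ (∫⁻ x, ‖p x‖ₑ ^ 2 * (W x)⁻¹ ∂μ) * ∫⁻ x, W x * ‖T x‖ₑ ^ 2 ∂μ :=
        sq_lintegral_mul_le hp.enorm hT.enorm.aemeasurable hW hW0 hWt
      _ ≤ (∫⁻ x, ‖p x‖ₑ ^ 2 * (W x)⁻¹ ∂μ) * (B * S) := by
        gcongr
        simpa only [RCLike.enorm_conj] using hB s fun i => (starRingEnd ℂ) (c i)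
      _ = _ := by ring
  rcases eq_or_ne S 0 with hS0 | hS0
  · exact hS0 ▸ zero_le
  · exact (ENNReal.mul_le_mul_iff_left hS0 (ENNReal.sum_ne_top.2 fun _ _ => by simp)).1 hS_sq

end CauchySchwarz

section TrigonometricPolynomials

variable {d : Type*}

/-- The half-open unit cell with lower corner `k`. Its faces are chosen to match
`UnitAddTorus.lintegral_preimage`. -/
def unitCell (k : d → ℤ) : Set (d → ℝ) := {x | ∀ i, x i ∈ Ioc (k i : ℝ) (k i + 1)}

lemma mem_unitCell_iff {k : d → ℤ} {x : d → ℝ} : x ∈ unitCell k ↔ k = fun i => ⌈x i⌉ - 1 := by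
  simp only [unitCell, mem_ofPred_eq, mem_Ioc, funext_iff]
  refine forall_congr' fun i => ?_
  rw [eq_sub_iff_add_eq, eq_comm (b := ⌈x i⌉), Int.ceil_eq_iff]
  push_cast
  rw [add_sub_cancel_right]

lemma measurableSet_unitCell [Countable d] (k : d → ℤ) : MeasurableSet (unitCell k) :=
  MeasurableSet.univ_pi' fun _ => measurableSet_Ioc

variable [Fintype d]

lemma volume_unitCell (k : d → ℤ) : volume (unitCell k) = 1 := by
  have : unitCell k = univ.pi fun i => Ioc (k i : ℝ) (k i + 1) := by ext; simp [unitCell]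
  simp [this, Real.volume_pi_Ioc]

lemma norm_sub_le_one_of_mem_unitCell {k : d → ℤ} {x y : d → ℝ} (hx : x ∈ unitCell k)
    (hy : y ∈ unitCell k) : ‖x - y‖ ≤ 1 := by
  refine (pi_norm_le_iff_of_nonneg zero_le_one).2 fun i => ?_
  have hxi := hx i
  have hyi := hy i
  rw [Pi.sub_apply, Real.norm_eq_abs, abs_le]
  constructor <;> linarith [hxi.1, hxi.2, hyi.1, hyi.2]

lemma lintegral_eq_tsum_unitCell (f : (d → ℝ) → ℝ≥0∞) :
    ∫⁻ x, f x = ∑' k : d → ℤ, ∫⁻ x in unitCell k, f x := by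
  have hcover : ⋃ k : d → ℤ, unitCell k = univ :=
    eq_univ_of_forall fun x => mem_iUnion.2 ⟨_, mem_unitCell_iff.2 rfl⟩
  rw [← lintegral_iUnion measurableSet_unitCell, hcover, Measure.restrict_univ]
  exact fun k l hkl => Set.disjoint_left.2 fun x hk hl =>
    hkl ((mem_unitCell_iff.1 hk).trans (mem_unitCell_iff.1 hl).symm)

lemma continuous_mFourier_coe (j : d → ℤ) :
    Continuous fun x : d → ℝ => UnitAddTorus.mFourier j (fun i => (x i : UnitAddCircle)) :=
  (UnitAddTorus.mFourier j).continuous.comp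
    (continuous_pi fun i => (AddCircle.continuous_mk' 1).comp (continuous_apply i))

section

attribute [local instance] instMeasureSpaceUnitAddCircle

lemma lintegral_enorm_sq_sum_mFourier (s : Finset (d → ℤ)) (α : (d → ℤ) → ℂ) :
    ∫⁻ x : UnitAddTorus d, ‖∑ j ∈ s, α j * UnitAddTorus.mFourier j x‖ₑ ^ 2 =
      ∑ j ∈ s, ‖α j‖ₑ ^ 2 := by
  have : IsProbabilityMeasure (volume : Measure UnitAddCircle) :=
    inferInstanceAs (IsProbabilityMeasure AddCircle.haarAddCircle)
  let f : C(UnitAddTorus d, ℂ) := ∑ j ∈ s, α j • UnitAddTorus.mFourier j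
  have hf : ContinuousMap.toLp 2 volume ℂ f = ∑ j ∈ s, α j • UnitAddTorus.mFourierLp 2 j := by
    simp [f, map_sum]
  have hnorm : ‖ContinuousMap.toLp (E := ℂ) 2 volume ℂ f‖ₑ ^ 2 = ∫⁻ x, ‖f x‖ₑ ^ 2 := by
    rw [Lp.enorm_def, eLpNorm_congr_ae (ContinuousMap.coeFn_toLp volume f),
      eLpNorm_eq_lintegral_rpow_enorm_toReal (by simp) (by simp), ← ENNReal.rpow_natCast,
      ← ENNReal.rpow_mul]
    simp
  rw [← enorm_sq_sum_smul_of_orthonormal UnitAddTorus.orthonormal_mFourier, ← hf, hnorm]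
  simp [f, ContinuousMap.sum_apply]

lemma setLIntegral_unitCell_enorm_sq_sum_mFourier (k : d → ℤ) (s : Finset (d → ℤ))
    (α : (d → ℤ) → ℂ) :
    ∫⁻ x in unitCell k,
        ‖∑ j ∈ s, α j * UnitAddTorus.mFourier j (fun i => (x i : UnitAddCircle))‖ₑ ^ 2 =
      ∑ j ∈ s, ‖α j‖ₑ ^ 2 := by
  rw [← lintegral_enorm_sq_sum_mFourier, UnitAddTorus.lintegral_preimage _ fun i => (k i : ℝ)]
  rfl

end

lemma lintegral_mul_enorm_sq_sum_mFourier_le {W : (d → ℝ) → ℝ≥0∞} {c : ℝ≥0∞} (hc : c ≠ ⊤)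
    (hW : ∀ x y, ‖x - y‖ ≤ 1 → W x ≤ c * W y) (s : Finset (d → ℤ)) (α : (d → ℤ) → ℂ) :
    ∫⁻ x, W x *
        ‖∑ j ∈ s, α j * UnitAddTorus.mFourier j (fun i => (x i : UnitAddCircle))‖ₑ ^ 2 ≤
      c * (∫⁻ x, W x) * ∑ j ∈ s, ‖α j‖ₑ ^ 2 := by
  have hcell (k : d → ℤ) (x : d → ℝ) (hx : x ∈ unitCell k) :
      W x ≤ c * ∫⁻ y in unitCell k, W y := by
    calc W x = ∫⁻ _ in unitCell k, W x := by rw [setLIntegral_const, volume_unitCell, mul_one]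
      _ ≤ ∫⁻ y in unitCell k, c * W y :=
        setLIntegral_mono' (measurableSet_unitCell k) fun y hy =>
          hW x y (norm_sub_le_one_of_mem_unitCell hx hy)
      _ = c * ∫⁻ y in unitCell k, W y := lintegral_const_mul' _ _ hc
  have hT : Continuous fun x : d → ℝ =>
      ∑ j ∈ s, α j * UnitAddTorus.mFourier j (fun i => (x i : UnitAddCircle)) :=
    continuous_finsetSum _ fun j _ => continuous_const.mul (continuous_mFourier_coe j)
  rw [lintegral_eq_tsum_unitCell, lintegral_eq_tsum_unitCell W, ← ENNReal.tsum_mul_left,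
    ← ENNReal.tsum_mul_right]
  refine ENNReal.tsum_le_tsum fun k => ?_
  rw [← setLIntegral_unitCell_enorm_sq_sum_mFourier k, ← lintegral_const_mul]
  · exact setLIntegral_mono' (measurableSet_unitCell k) fun x hx => by gcongr; exact hcell k x hx
  · exact hT.enorm.measurable.pow_const 2

end TrigonometricPolynomials

section Bessel

lemma inv_one_add_enorm_pow_le {E : Type*} [SeminormedAddCommGroup E] {x y : E}
    (hxy : ‖x - y‖ ≤ 1) (n : ℕ) :
    ((1 + ‖x‖ₑ) ^ n)⁻¹ ≤ 2 ^ n * ((1 + ‖y‖ₑ) ^ n)⁻¹ := by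
  have hxy' : ‖x - y‖ₑ ≤ 1 := by simpa [← ofReal_norm] using hxy
  have hle : 1 + ‖y‖ₑ ≤ 2 * (1 + ‖x‖ₑ) := by
    calc 1 + ‖y‖ₑ = 1 + ‖x - (x - y)‖ₑ := by rw [sub_sub_cancel]
      _ ≤ 1 + (‖x‖ₑ + 1) := by gcongr; exact enorm_sub_le.trans (by gcongr)
      _ ≤ 1 + (‖x‖ₑ + 1) + ‖x‖ₑ := le_self_add
      _ = 2 * (1 + ‖x‖ₑ) := by ring
  calc ((1 + ‖x‖ₑ) ^ n)⁻¹ = 2 ^ n * ((2 * (1 + ‖x‖ₑ)) ^ n)⁻¹ := by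
        rw [mul_pow, ENNReal.mul_inv (by simp) (by simp), ← mul_assoc,
          ENNReal.mul_inv_cancel (by simp) (by simp), one_mul]
    _ ≤ 2 ^ n * ((1 + ‖y‖ₑ) ^ n)⁻¹ := by gcongr

lemma lintegral_inv_one_add_enorm_pow_lt_top {E : Type*} [NormedAddCommGroup E] [NormedSpace ℝ E]
    [FiniteDimensional ℝ E] [MeasurableSpace E] [BorelSpace E] (μ : Measure E)
    [μ.IsAddHaarMeasure] {n : ℕ} (hn : Module.finrank ℝ E < n) :
    ∫⁻ x, ((1 + ‖x‖ₑ) ^ n)⁻¹ ∂μ < ⊤ := by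
  refine lt_of_eq_of_lt (lintegral_congr fun x => ?_)
    (finite_integral_one_add_norm (μ := μ) (r := n) (by exact_mod_cast hn))
  rw [Real.rpow_neg (by positivity), Real.rpow_natCast, ENNReal.ofReal_inv_of_pos (by positivity),
    ENNReal.ofReal_pow (by positivity), ENNReal.ofReal_add zero_le_one (norm_nonneg x), ofReal_norm,
    ENNReal.ofReal_one]

variable {d : Type*} [Fintype d]

variable (d) in
/-- The constant in Bessel's inequality for the restriction of `𝓕 p` to the integer lattice of
`ℝᵈ`, when `p` is measured in `L²` with the weight `(1 + |x|)^{d+1}`. -/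
def besselConst : ℝ≥0∞ :=
  2 ^ (Fintype.card d + 1) * ∫⁻ x : d → ℝ, ((1 + ‖x‖ₑ) ^ (Fintype.card d + 1))⁻¹

lemma besselConst_ne_top : besselConst d ≠ ⊤ :=
  ENNReal.mul_ne_top (by simp) (lintegral_inv_one_add_enorm_pow_lt_top volume (by simp)).ne

lemma tsum_enorm_sq_integral_mul_mFourier_le {p : (d → ℝ) → ℂ} (hp : Integrable p) :
    ∑' j : d → ℤ,
        ‖∫ x, p x * UnitAddTorus.mFourier j (fun i => (x i : UnitAddCircle))‖ₑ ^ 2 ≤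
      besselConst d * ∫⁻ x, ‖p x‖ₑ ^ 2 * (1 + ‖x‖ₑ) ^ (Fintype.card d + 1) := by
  have h := tsum_enorm_sq_integral_mul_le (μ := volume)
    (fun j : d → ℤ => (continuous_mFourier_coe j).measurable)
    (W := fun x => ((1 + ‖x‖ₑ) ^ (Fintype.card d + 1))⁻¹) (by fun_prop) (by simp) (by simp)
    (lintegral_mul_enorm_sq_sum_mFourier_le (by simp)
      fun x y hxy => inv_one_add_enorm_pow_le hxy _) hp.aemeasurable
    fun j => hp.mul_bdd (c := 1) (continuous_mFourier_coe j).aestronglyMeasurable <|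
      .of_forall fun x => ((UnitAddTorus.mFourier j).norm_coe_le_norm _).trans
        UnitAddTorus.mFourier_norm.le
  simpa only [inv_inv, besselConst] using h

lemma mFourier_neg_coe (j : d → ℤ) (x : d → ℝ) :
    UnitAddTorus.mFourier (-j) (fun i => (x i : UnitAddCircle)) =
      Real.fourierChar (-inner ℝ (WithLp.toLp 2 x) (WithLp.toLp 2 fun i => (j i : ℝ))) := by
  simp only [UnitAddTorus.mFourier, ContinuousMap.coe_mk, fourier_coe_apply, ← Complex.exp_sum,
    Real.fourierChar_apply, PiLp.inner_apply]
  congr 1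
  push_cast [Finset.mul_sum, Finset.sum_mul, RCLike.inner_apply, Real.ringHom_apply]
  rw [← Finset.sum_neg_distrib, Finset.mul_sum, Finset.sum_mul]
  refine Finset.sum_congr rfl fun i _ => ?_
  simp only [Pi.neg_apply]
  push_cast
  ring

lemma tsum_enorm_sq_fourier_lattice_le {p : EuclideanSpace ℝ d → ℂ} (hp : Integrable p) :
    ∑' j : d → ℤ, ‖𝓕 p (WithLp.toLp 2 fun i => (j i : ℝ))‖ₑ ^ 2 ≤
      besselConst d * ∫⁻ v, ‖p v‖ₑ ^ 2 * (1 + ‖v‖ₑ) ^ (Fintype.card d + 1) := by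
  have hmp := PiLp.volume_preserving_toLp d
  have hme : MeasurableEmbedding (WithLp.toLp 2 : (d → ℝ) → EuclideanSpace ℝ d) :=
    (MeasurableEquiv.toLp 2 (d → ℝ)).measurableEmbedding
  have hfourier (j : d → ℤ) : 𝓕 p (WithLp.toLp 2 fun i => (j i : ℝ)) =
      ∫ x : d → ℝ, p (WithLp.toLp 2 x) *
        UnitAddTorus.mFourier (-j) (fun i => (x i : UnitAddCircle)) := by
    rw [Real.fourier_eq, ← hmp.integral_comp hme]
    simp only [mFourier_neg_coe, Circle.smul_def, smul_eq_mul, mul_comm]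
  calc ∑' j : d → ℤ, ‖𝓕 p (WithLp.toLp 2 fun i => (j i : ℝ))‖ₑ ^ 2
      = ∑' j : d → ℤ, ‖∫ x : d → ℝ, p (WithLp.toLp 2 x) *
          UnitAddTorus.mFourier j (fun i => (x i : UnitAddCircle))‖ₑ ^ 2 := by
        simp only [hfourier]
        exact (Equiv.neg (d → ℤ)).tsum_eq fun j => ‖∫ x : d → ℝ, p (WithLp.toLp 2 x) *
          UnitAddTorus.mFourier j (fun i => (x i : UnitAddCircle))‖ₑ ^ 2
    _ ≤ besselConst d *
          ∫⁻ x : d → ℝ, ‖p (WithLp.toLp 2 x)‖ₑ ^ 2 * (1 + ‖x‖ₑ) ^ (Fintype.card d + 1) :=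
        tsum_enorm_sq_integral_mul_mFourier_le ((hmp.integrable_comp_emb hme).2 hp)
    _ ≤ _ := by
        rw [← hmp.lintegral_comp_emb hme]
        gcongr with x
        exact enorm_le_iff_norm_le.2 <| (pi_norm_le_iff_of_nonneg (norm_nonneg _)).2 fun i =>
          PiLp.norm_apply_le (WithLp.toLp 2 x) i

end Bessel

section Localization

open scoped InnerProductSpace

variable {V : Type*} [NormedAddCommGroup V] [InnerProductSpace ℝ V] [FiniteDimensional ℝ V]
  [MeasurableSpace V] [BorelSpace V]

lemma continuous_fourierInv {f : V → ℂ} (hf : Integrable f) : Continuous (𝓕⁻ f) := by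
  rw [show 𝓕⁻ f = fun v => 𝓕 f (-v) from funext (Real.fourierInv_eq_fourier_neg f)]
  exact (VectorFourier.fourierIntegral_continuous Real.continuous_fourierChar
    (innerSL ℝ).continuous₂ hf).comp continuous_neg

lemma norm_fourierInv_le (f : V → ℂ) (y : V) : ‖𝓕⁻ f y‖ ≤ ∫ η, ‖f η‖ := by
  rw [Real.fourierInv_eq_fourier_neg]
  exact VectorFourier.norm_fourierIntegral_le_integral_norm _ _ _ _ _

lemma integrable_fourier_mul_fourierInv_translate (θ : 𝓢(V, ℂ)) {f : V → ℂ} (hf : Integrable f)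
    (R : ℝ) (y : V) : Integrable fun v => 𝓕 θ v * 𝓕⁻ f (y + R • v) :=
  (𝓕 θ).integrable.mul_bdd
    ((continuous_fourierInv hf).comp (by fun_prop)).aestronglyMeasurable
    (.of_forall fun _ => norm_fourierInv_le f _)

lemma fourierInv_dilate_translate_mul (θ : 𝓢(V, ℂ)) {f : V → ℂ} (hf : Integrable f) (R : ℝ)
    (y ζ : V) :
    𝓕⁻ (fun η => θ (R • η - ζ) * f η) y = 𝓕 (fun v => 𝓕 θ v * 𝓕⁻ f (y + R • v)) ζ := by
  have hθ (ξ : V) : θ ξ = ∫ v, (Real.fourierChar ⟪v, ξ⟫_ℝ : ℂ) * 𝓕 θ v := by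
    simp only [← smul_eq_mul, ← Circle.smul_def]
    rw [← Real.fourierInv_eq, ← SchwartzMap.fourierInv_coe, FourierTransform.fourierInv_fourier_eq]
  have hphase (η v : V) :
      (Real.fourierChar ⟪η, y⟫_ℝ : ℂ) * Real.fourierChar ⟪v, R • η - ζ⟫_ℝ =
        Real.fourierChar (-⟪v, ζ⟫_ℝ) * Real.fourierChar ⟪η, y + R • v⟫_ℝ := by
    rw [← Circle.coe_mul, ← Circle.coe_mul, ← AddChar.map_add_eq_mul, ← AddChar.map_add_eq_mul,
      inner_sub_right, inner_add_right, real_inner_smul_right, real_inner_smul_right,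
      real_inner_comm η v]
    ring_nf
  let k : V → V → ℂ := fun η v =>
    (Real.fourierChar ⟪η, y⟫_ℝ * Real.fourierChar ⟪v, R • η - ζ⟫_ℝ : ℂ) * (f η * 𝓕 θ v)
  have hk : Integrable (Function.uncurry k) (volume.prod volume) := by
    have hcont : Continuous fun q : V × V =>
        (Real.fourierChar ⟪q.1, y⟫_ℝ * Real.fourierChar ⟪q.2, R • q.1 - ζ⟫_ℝ : ℂ) := by
      fun_prop
    exact (hf.mul_prod (𝓕 θ).integrable).bdd_mul (c := 1) hcont.aestronglyMeasurable
      (.of_forall fun _ => by simp only [norm_mul, Circle.norm_coe, mul_one, le_refl])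
  calc 𝓕⁻ (fun η => θ (R • η - ζ) * f η) y = ∫ η, ∫ v, k η v := by
        simp only [Real.fourierInv_eq, hθ (R • _ - ζ), k, Circle.smul_def, smul_eq_mul,
          ← integral_mul_const, ← integral_const_mul]
        refine integral_congr_ae (.of_forall fun _ => integral_congr_ae (.of_forall fun _ => ?_))
        ring
    _ = ∫ v, ∫ η, k η v := integral_integral_swap hk
    _ = _ := by
        simp only [Real.fourier_eq, Real.fourierInv_eq, k, hphase, Circle.smul_def, smul_eq_mul,
          ← integral_const_mul]
        refine integral_congr_ae (.of_forall fun _ => integral_congr_ae (.of_forall fun _ => ?_))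
        ring

lemma lintegral_enorm_sq_mul_one_add_enorm_pow_ne_top (ψ : 𝓢(V, ℂ)) (n : ℕ) :
    ∫⁻ v, ‖ψ v‖ₑ ^ 2 * (1 + ‖v‖ₑ) ^ n ≠ ⊤ := by
  obtain ⟨M, hM⟩ : ∃ M : ℝ, ∀ v, (1 + ‖v‖) ^ n * ‖ψ v‖ ≤ M :=
    ⟨_, fun v => by
      simpa only [norm_iteratedFDeriv_zero] using
        SchwartzMap.one_add_le_sup_seminorm_apply (𝕜 := ℂ) (m := (n, 0)) le_rfl le_rfl ψ v⟩
  have hM' (v : V) : (1 + ‖v‖ₑ) ^ n * ‖ψ v‖ₑ ≤ ENNReal.ofReal M := by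
    refine le_of_eq_of_le ?_ (ENNReal.ofReal_le_ofReal (hM v))
    rw [ENNReal.ofReal_mul (by positivity), ENNReal.ofReal_pow (by positivity),
      ENNReal.ofReal_add zero_le_one (norm_nonneg v), ofReal_norm, ofReal_norm, ENNReal.ofReal_one]
  refine ne_top_of_le_ne_top
    (ENNReal.mul_ne_top (ENNReal.ofReal_ne_top (r := M)) ψ.integrable.2.ne)
    ((lintegral_mono fun v => ?_).trans_eq (lintegral_const_mul' _ _ ENNReal.ofReal_ne_top))
  calc ‖ψ v‖ₑ ^ 2 * (1 + ‖v‖ₑ) ^ n = (1 + ‖v‖ₑ) ^ n * ‖ψ v‖ₑ * ‖ψ v‖ₑ := by ring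
    _ ≤ ENNReal.ofReal M * ‖ψ v‖ₑ := by gcongr; exact hM' v

variable {d : Type*} [Fintype d]

/-- The density with which translates of `𝓕⁻ f` are averaged to dominate the square function of
the localizations of `f` by the integer translates of `θ(R ·)`; the averaging variable is measured
in units of the dual scale `R`. -/
def blockKernel (θ : 𝓢(EuclideanSpace ℝ d, ℂ)) (v : EuclideanSpace ℝ d) : ℝ≥0∞ :=
  besselConst d * (‖𝓕 θ v‖ₑ ^ 2 * (1 + ‖v‖ₑ) ^ (Fintype.card d + 1))

lemma measurable_blockKernel (θ : 𝓢(EuclideanSpace ℝ d, ℂ)) : Measurable (blockKernel θ) := by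
  have := (𝓕 θ).continuous
  unfold blockKernel
  fun_prop

lemma lintegral_blockKernel_mul_one_add_enorm_pow_ne_top (θ : 𝓢(EuclideanSpace ℝ d, ℂ)) (n : ℕ) :
    ∫⁻ v, blockKernel θ v * (1 + ‖v‖ₑ) ^ n ≠ ⊤ := by
  simp only [blockKernel, mul_assoc, ← pow_add]
  rw [lintegral_const_mul' _ _ besselConst_ne_top]
  exact ENNReal.mul_ne_top besselConst_ne_top
    (lintegral_enorm_sq_mul_one_add_enorm_pow_ne_top (𝓕 θ) _)

lemma tsum_enorm_sq_fourierInv_block_le (θ : 𝓢(EuclideanSpace ℝ d, ℂ))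
    {f : EuclideanSpace ℝ d → ℂ} (hf : Integrable f) (R : ℝ) (y : EuclideanSpace ℝ d) :
    ∑' j : d → ℤ,
        ‖𝓕⁻ (fun η => θ (R • η - WithLp.toLp 2 fun i => (j i : ℝ)) * f η) y‖ₑ ^ 2 ≤
      ∫⁻ v, blockKernel θ v * ‖𝓕⁻ f (y + R • v)‖ₑ ^ 2 := by
  simp only [fourierInv_dilate_translate_mul θ hf]
  refine (tsum_enorm_sq_fourier_lattice_le
    (integrable_fourier_mul_fourierInv_translate θ hf R y)).trans_eq ?_
  rw [← lintegral_const_mul' _ _ besselConst_ne_top]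
  refine lintegral_congr fun v => ?_
  rw [blockKernel, enorm_mul]
  ring

end Localization

section Extension

lemma extension_congr {h h' : Plane → ℝ} {b : Plane → ℂ} (hh : ∀ η, b η ≠ 0 → h η = h' η)
    (g : Plane → ℂ) : extension h b g = extension h' b g := by
  funext z
  refine integral_congr_ae (.of_forall fun η => ?_)
  rcases eq_or_ne (b η) 0 with hb | hb
  · simp only [hb, mul_zero, zero_mul]
  · simp only [hh η hb]

lemma extension_eq_fourierInv (h : Plane → ℝ) (b g : Plane → ℂ) (z : SpaceTime) :
    extension h b g z =
      𝓕⁻ (fun η => Complex.exp (Complex.I * ((z.2 * h η : ℝ) : ℂ)) * (b η * g η))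
        ((2 * Real.pi)⁻¹ • z.1) := by
  rw [extension, Real.fourierInv_eq']
  refine integral_congr_ae (.of_forall fun η => ?_)
  have hphase : 2 * Real.pi * inner ℝ η ((2 * Real.pi)⁻¹ • z.1) = inner ℝ z.1 η := by
    rw [real_inner_smul_right, mul_inv_cancel_left₀ (by positivity), real_inner_comm]
  simp only [hphase, smul_eq_mul, mul_comm Complex.I, Complex.ofReal_add, add_mul,
    Complex.exp_add]
  ring

variable {h : Plane → ℝ} {b g : Plane → ℂ}

lemma continuous_extension (hh : Measurable h) (hbg : Integrable fun η => b η * g η) :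
    Continuous (extension h b g) := by
  unfold extension
  simp only [mul_assoc _ (b _)]
  refine continuous_of_dominated (bound := fun η => ‖b η * g η‖) (fun z => ?_) (fun z => ?_)
    hbg.norm (.of_forall fun η => by fun_prop)
  · exact (Measurable.aestronglyMeasurable (by fun_prop)).mul hbg.1
  · exact .of_forall fun η => by rw [norm_mul, Complex.norm_exp_I_mul_ofReal, one_mul]

lemma tsum_enorm_sq_extension_block_le (θ : 𝓢(Plane, ℂ)) (hh : Measurable h)
    (hbg : Integrable fun η => b η * g η) (R : ℝ) (z : SpaceTime) :
    ∑' j : Fin 2 → ℤ, ‖extension h (fun η => θ (R • η - latticePt j) * b η) g z‖ₑ ^ 2 ≤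
      ∫⁻ v, blockKernel θ v * ‖extension h b g (z + ((2 * Real.pi * R) • v, 0))‖ₑ ^ 2 := by
  have hmod : Integrable fun η =>
      Complex.exp (Complex.I * ((z.2 * h η : ℝ) : ℂ)) * (b η * g η) :=
    hbg.bdd_mul (c := 1) (Measurable.aestronglyMeasurable (by fun_prop))
      (.of_forall fun _ => (Complex.norm_exp_I_mul_ofReal _).le)
  have hscale (v : Plane) : (2 * Real.pi)⁻¹ • (z.1 + (2 * Real.pi * R) • v) =
      (2 * Real.pi)⁻¹ • z.1 + R • v := by
    rw [smul_add, smul_smul, inv_mul_cancel_left₀ (by positivity)]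
  have hmul_comm (j : Fin 2 → ℤ) :
      (fun η => Complex.exp (Complex.I * ((z.2 * h η : ℝ) : ℂ)) *
        (θ (R • η - latticePt j) * b η * g η)) = fun η => θ (R • η - latticePt j) *
          (Complex.exp (Complex.I * ((z.2 * h η : ℝ) : ℂ)) * (b η * g η)) :=
    funext fun η => by ring
  simp only [extension_eq_fourierInv, Prod.fst_add, Prod.snd_add, add_zero, hscale, hmul_comm]
  exact tsum_enorm_sq_fourierInv_block_le θ hmod R _

end Extension

section Averages

variable {Y : Type*} [MeasurableSpace Y] {ν : Measure Y} {V : Y → ℝ≥0∞} {p : ℝ}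

lemma rpow_lintegral_mul_le {G : Y → ℝ≥0∞} (hV : AEMeasurable V ν) (hG : AEMeasurable G ν)
    (hp : 1 ≤ p) :
    (∫⁻ y, V y * G y ∂ν) ^ p ≤ (∫⁻ y, V y ∂ν) ^ (p - 1) * ∫⁻ y, V y * G y ^ p ∂ν := by
  have hp0 : 0 < p := zero_lt_one.trans_le hp
  have hp1 : 0 ≤ 1 - p⁻¹ := sub_nonneg.2 (inv_le_one_of_one_le₀ hp)
  have hVG (y : Y) : V y * G y = V y ^ (1 - p⁻¹) * (V y * G y ^ p) ^ p⁻¹ := by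
    rw [ENNReal.mul_rpow_of_nonneg _ _ (by positivity), ENNReal.rpow_rpow_inv hp0.ne', ← mul_assoc,
      ← ENNReal.rpow_add_of_nonneg _ _ hp1 (by positivity), sub_add_cancel, ENNReal.rpow_one]
  calc (∫⁻ y, V y * G y ∂ν) ^ p
      ≤ ((∫⁻ y, V y ∂ν) ^ (1 - p⁻¹) * (∫⁻ y, V y * G y ^ p ∂ν) ^ p⁻¹) ^ p := by
        simp only [hVG]
        gcongr
        exact ENNReal.lintegral_mul_norm_pow_le hV (hV.mul (hG.pow_const p)) hp1 (by positivity)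
          (sub_add_cancel _ _)
    _ = _ := by
        rw [ENNReal.mul_rpow_of_nonneg _ _ hp0.le, ENNReal.rpow_inv_rpow hp0.ne',
          ← ENNReal.rpow_mul, sub_mul, one_mul, inv_mul_cancel₀ hp0.ne']

variable {X : Type*} [MeasurableSpace X] [AddGroup X] {μ : Measure X} [μ.IsAddRightInvariant]
  {G w : X → ℝ≥0∞}

lemma lintegral_translate_rpow_mul_le [MeasurableAdd X] {c : ℝ≥0∞} (hc : c ≠ ⊤) (u : X)
    (hw : ∀ z, w (z - u) ≤ c * w z) :
    ∫⁻ z, G (z + u) ^ p * w z ∂μ ≤ c * ∫⁻ z, G z ^ p * w z ∂μ :=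
  calc ∫⁻ z, G (z + u) ^ p * w z ∂μ = ∫⁻ z, G z ^ p * w (z - u) ∂μ := by
        rw [← lintegral_add_right_eq_self (fun z => G z ^ p * w (z - u)) u]
        simp only [add_sub_cancel_right]
    _ ≤ ∫⁻ z, c * (G z ^ p * w z) ∂μ := by
        refine lintegral_mono fun z => ?_
        rw [mul_left_comm]
        gcongr
        exact hw z
    _ = c * ∫⁻ z, G z ^ p * w z ∂μ := lintegral_const_mul' _ _ hc

lemma lintegral_average_translate_rpow_mul_le [MeasurableAdd₂ X] [SFinite μ] [SFinite ν]
    (hV : Measurable V) (hG : Measurable G) (hw : Measurable w) {u : Y → X} (hu : Measurable u)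
    {m : Y → ℝ≥0∞} (hm : Measurable m) (hmt : ∀ y, m y ≠ ⊤)
    (hwm : ∀ y z, w (z - u y) ≤ m y * w z) (hp : 1 ≤ p) :
    ∫⁻ z, (∫⁻ y, V y * G (z + u y) ∂ν) ^ p * w z ∂μ ≤
      (∫⁻ y, V y ∂ν) ^ (p - 1) * (∫⁻ y, V y * m y ∂ν) * ∫⁻ z, G z ^ p * w z ∂μ := by
  have hjoint : Measurable fun q : X × Y => V q.2 * (G (q.1 + u q.2) ^ p * w q.1) := by fun_prop
  calc ∫⁻ z, (∫⁻ y, V y * G (z + u y) ∂ν) ^ p * w z ∂μ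
      ≤ ∫⁻ z, (∫⁻ y, V y ∂ν) ^ (p - 1) * ∫⁻ y, V y * (G (z + u y) ^ p * w z) ∂ν ∂μ := by
        refine lintegral_mono fun z => ?_
        simp only [← mul_assoc (V _)]
        rw [lintegral_mul_const _ (by fun_prop), ← mul_assoc]
        gcongr
        exact rpow_lintegral_mul_le hV.aemeasurable (by fun_prop) hp
    _ = (∫⁻ y, V y ∂ν) ^ (p - 1) * ∫⁻ y, V y * ∫⁻ z, G (z + u y) ^ p * w z ∂μ ∂ν := by
        rw [lintegral_const_mul _ hjoint.lintegral_prod_right',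
          lintegral_lintegral_swap hjoint.aemeasurable]
        congr! 3 with y
        exact lintegral_const_mul (V y) (by fun_prop)
    _ ≤ (∫⁻ y, V y ∂ν) ^ (p - 1) * ∫⁻ y, V y * (m y * ∫⁻ z, G z ^ p * w z ∂μ) ∂ν := by
        gcongr with y
        exact lintegral_translate_rpow_mul_le (hmt y) (u y) (hwm y)
    _ = _ := by
        simp only [← mul_assoc]
        rw [lintegral_mul_const _ (by fun_prop), mul_assoc]

end Averages

section AdaptedWeight

lemma stNorm_eq_norm_toLp (z : SpaceTime) : stNorm z = ‖WithLp.toLp 2 z‖ := by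
  simp only [WithLp.prod_norm_eq_of_L2, stNorm, Real.norm_eq_abs, sq_abs, WithLp.toLp_fst,
    WithLp.toLp_snd]

lemma stNorm_nonneg (z : SpaceTime) : 0 ≤ stNorm z := Real.sqrt_nonneg _

lemma stNorm_add_le (z u : SpaceTime) : stNorm (z + u) ≤ stNorm z + stNorm u := by
  simpa only [stNorm_eq_norm_toLp, WithLp.toLp_add] using norm_add_le _ _

lemma stNorm_mk_zero (x : Plane) : stNorm (x, 0) = ‖x‖ := by simp [stNorm]

variable {w : SpaceTime → ℝ} {r A : ℝ} {N : ℕ}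

lemma IsAdaptedWeight.translate_le (hw : IsAdaptedWeight w r N A) (hr : 0 < r) (hA : 0 < A)
    (z u : SpaceTime) : w (z - u) ≤ A ^ 2 * (1 + stNorm u / r) ^ N * w z := by
  have hz := stNorm_nonneg z
  have hu := stNorm_nonneg u
  have hzu := stNorm_nonneg (z - u)
  have hdist : 1 + stNorm z / r ≤ (1 + stNorm u / r) * (1 + stNorm (z - u) / r) := by
    calc 1 + stNorm z / r ≤ 1 + (stNorm (z - u) + stNorm u) / r := by
          gcongr
          simpa only [sub_add_cancel] using stNorm_add_le (z - u) u
      _ ≤ 1 + (stNorm (z - u) + stNorm u) / r + stNorm u / r * (stNorm (z - u) / r) :=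
          le_add_of_nonneg_right (by positivity)
      _ = (1 + stNorm u / r) * (1 + stNorm (z - u) / r) := by ring
  have hinv : ((1 + stNorm (z - u) / r) ^ N)⁻¹ ≤
      (1 + stNorm u / r) ^ N * ((1 + stNorm z / r) ^ N)⁻¹ := by
    rw [← div_eq_mul_inv, le_div_iff₀ (by positivity), inv_mul_le_iff₀ (by positivity), mul_comm,
      ← mul_pow]
    gcongr
  calc w (z - u) ≤ A * ((1 + stNorm (z - u) / r) ^ N)⁻¹ := hw.upper _
    _ ≤ A * ((1 + stNorm u / r) ^ N * (A * w z)) := by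
        gcongr
        exact hinv.trans (by gcongr; exact (inv_mul_le_iff₀ hA).1 (hw.lower z))
    _ = _ := by ring

lemma IsAdaptedWeight.ofReal_translate_le (hw : IsAdaptedWeight w r N A) (hr : 0 < r) (hA : 0 < A)
    {s : ℝ} (hrs : r ≤ s) (v : Plane) (z : SpaceTime) :
    ENNReal.ofReal (w (z - (s • v, 0))) ≤
      ENNReal.ofReal (A ^ 2 * (s / r) ^ N) * (1 + ‖v‖ₑ) ^ N * ENNReal.ofReal (w z) := by
  have hs : 0 < s := hr.trans_le hrs
  have hbase : 1 + stNorm (s • v, 0) / r ≤ s / r * (1 + ‖v‖) := by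
    rw [stNorm_mk_zero, norm_smul, Real.norm_of_nonneg hs.le, mul_one_add, div_mul_eq_mul_div]
    gcongr
    exact (one_le_div hr).2 hrs
  have hpow : A ^ 2 * (1 + stNorm (s • v, 0) / r) ^ N ≤ A ^ 2 * (s / r) ^ N * (1 + ‖v‖) ^ N := by
    rw [mul_assoc, ← mul_pow]
    have := stNorm_nonneg (s • v, 0)
    gcongr
  calc ENNReal.ofReal (w (z - (s • v, 0)))
      ≤ ENNReal.ofReal (A ^ 2 * (1 + stNorm (s • v, 0) / r) ^ N) * ENNReal.ofReal (w z) := by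
        have := stNorm_nonneg (s • v, 0)
        rw [← ENNReal.ofReal_mul (by positivity)]
        exact ENNReal.ofReal_le_ofReal (hw.translate_le hr hA z _)
    _ ≤ ENNReal.ofReal (A ^ 2 * (s / r) ^ N * (1 + ‖v‖) ^ N) * ENNReal.ofReal (w z) := by gcongr
    _ = _ := by
        rw [ENNReal.ofReal_mul (by positivity), ENNReal.ofReal_pow (p := 1 + ‖v‖) (by positivity),
          ENNReal.ofReal_add zero_le_one (norm_nonneg v), ofReal_norm, ENNReal.ofReal_one]

end AdaptedWeight

section SquareFunctionEstimate

lemma squareFun_rpow {ι : Type} (F : ι → SpaceTime → ℂ) (z : SpaceTime) :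
    squareFun F z ^ (10 / 3 : ℝ) = (∑' i, ‖F i z‖ₑ ^ 2) ^ (5 / 3 : ℝ) := by
  rw [squareFun, ← ENNReal.rpow_mul]
  norm_num

variable {ι : Type} [Countable ι] {h : Plane → ℝ} {b : ι → Plane → ℂ} {g : Plane → ℂ}

lemma tsum_enorm_sq_extension_blocks_le (θ : 𝓢(Plane, ℂ)) (hh : Measurable h)
    (hbg : ∀ ν, Integrable fun η => b ν η * g η) (R : ℝ) (z : SpaceTime) :
    ∑' i : ι × (Fin 2 → ℤ),
        ‖extension h (fun η => θ (R • η - latticePt i.2) * b i.1 η) g z‖ₑ ^ 2 ≤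
      ∫⁻ v, blockKernel θ v *
        ∑' ν, ‖extension h (b ν) g (z + ((2 * Real.pi * R) • v, 0))‖ₑ ^ 2 := by
  have hmeas (ν : ι) : Measurable fun v : Plane =>
      blockKernel θ v * ‖extension h (b ν) g (z + ((2 * Real.pi * R) • v, 0))‖ₑ ^ 2 := by
    have := measurable_blockKernel θ
    have := (continuous_extension hh (hbg ν)).measurable
    fun_prop
  simp only [← ENNReal.tsum_mul_left]
  rw [ENNReal.tsum_prod', lintegral_tsum fun ν => (hmeas ν).aemeasurable]
  exact ENNReal.tsum_le_tsum fun ν => tsum_enorm_sq_extension_block_le θ hh (hbg ν) R z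

lemma lintegral_squareFun_block_rpow_le (θ : 𝓢(Plane, ℂ)) (hh : Measurable h)
    (hbg : ∀ ν, Integrable fun η => b ν η * g η) {w : SpaceTime → ℝ} {r R A : ℝ} {N : ℕ}
    (hA : 0 < A) (hr : 0 < r) (hrR : r ≤ R) (hw : IsAdaptedWeight w r N A) :
    ∫⁻ z, squareFun (fun i : ι × (Fin 2 → ℤ) =>
        extension h (fun η => θ (R • η - latticePt i.2) * b i.1 η) g) z ^ (10 / 3 : ℝ) *
          ENNReal.ofReal (w z) ≤
      (∫⁻ v, blockKernel θ v) ^ (2 / 3 : ℝ) *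
        (∫⁻ v, blockKernel θ v *
          (ENNReal.ofReal (A ^ 2 * (2 * Real.pi * R / r) ^ N) * (1 + ‖v‖ₑ) ^ N)) *
        ∫⁻ z, squareFun (fun ν => extension h (b ν) g) z ^ (10 / 3 : ℝ) *
          ENNReal.ofReal (w z) := by
  have : (volume : Measure SpaceTime).IsAddRightInvariant := Measure.prod.instIsAddRightInvariant
  have hrs : r ≤ 2 * Real.pi * R :=
    hrR.trans (le_mul_of_one_le_left (hr.le.trans hrR) (by linarith [Real.two_le_pi]))
  have hG : Measurable fun z => ∑' ν, ‖extension h (b ν) g z‖ₑ ^ 2 :=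
    .tsum fun ν => ((continuous_extension hh (hbg ν)).measurable.enorm.pow_const 2)
  have havg := lintegral_average_translate_rpow_mul_le (μ := volume) (ν := volume) (p := 5 / 3)
    (measurable_blockKernel θ) hG hw.measurable.ennreal_ofReal
    (u := fun v : Plane => ((2 * Real.pi * R) • v, 0)) (by fun_prop) (by fun_prop)
    (fun v => by finiteness) (hw.ofReal_translate_le hr hA hrs) (by norm_num)
  rw [show (5 / 3 - 1 : ℝ) = 2 / 3 by norm_num] at havg
  simp only [squareFun_rpow]
  refine (lintegral_mono fun z => ?_).trans havg
  gcongr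
  exact tsum_enorm_sq_extension_blocks_le θ hh hbg R z

lemma exists_weightedNorm_squareFun_block_le (θ : 𝓢(Plane, ℂ)) (N : ℕ) {A : ℝ} (hA : 0 < A) :
    ∃ C : ℝ, ∀ {ι : Type} [Countable ι] {h : Plane → ℝ} {b : ι → Plane → ℂ} {g : Plane → ℂ},
      Measurable h → (∀ ν, Integrable fun η => b ν η * g η) →
      ∀ {w : SpaceTime → ℝ} {r R : ℝ}, 0 < r → r ≤ R → IsAdaptedWeight w r N A →
        weightedNorm w (squareFun fun i : ι × (Fin 2 → ℤ) =>
            extension h (fun η => θ (R • η - latticePt i.2) * b i.1 η) g) ≤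
          ENNReal.ofReal (C * (R / r) ^ (3 / 10 * N : ℝ)) *
            weightedNorm w (squareFun fun ν => extension h (b ν) g) := by
  let D : ℝ≥0∞ := (∫⁻ v, blockKernel θ v) ^ (2 / 3 : ℝ) *
    (ENNReal.ofReal (A ^ 2 * (2 * Real.pi) ^ N) * ∫⁻ v, blockKernel θ v * (1 + ‖v‖ₑ) ^ N)
  have hD : D ≠ ⊤ := by
    have hV : ∫⁻ v, blockKernel θ v ≠ ⊤ := by
      simpa using lintegral_blockKernel_mul_one_add_enorm_pow_ne_top θ 0
    have := lintegral_blockKernel_mul_one_add_enorm_pow_ne_top θ N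
    finiteness
  refine ⟨D.toReal ^ (3 / 10 : ℝ), fun {ι _ h b g} hh hbg {w r R} hr hrR hw => ?_⟩
  have hR : 0 < R := hr.trans_le hrR
  have hconst : (∫⁻ v, blockKernel θ v) ^ (2 / 3 : ℝ) *
      (∫⁻ v, blockKernel θ v *
        (ENNReal.ofReal (A ^ 2 * (2 * Real.pi * R / r) ^ N) * (1 + ‖v‖ₑ) ^ N)) =
      ENNReal.ofReal (D.toReal * (R / r) ^ N) := by
    simp only [mul_left_comm (blockKernel θ _)]
    rw [lintegral_const_mul' _ _ ENNReal.ofReal_ne_top, mul_div_assoc, mul_pow, ← mul_assoc (A ^ 2),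
      ENNReal.ofReal_mul (by positivity), ENNReal.ofReal_mul ENNReal.toReal_nonneg,
      ENNReal.ofReal_toReal hD]
    ring
  have hpow : (D.toReal * (R / r) ^ N) ^ (3 / 10 : ℝ) =
      D.toReal ^ (3 / 10 : ℝ) * (R / r) ^ (3 / 10 * N : ℝ) := by
    rw [Real.mul_rpow ENNReal.toReal_nonneg (by positivity), ← Real.rpow_natCast,
      ← Real.rpow_mul (by positivity), mul_comm (N : ℝ)]
  rw [weightedNorm, weightedNorm, ← hpow, ← ENNReal.ofReal_rpow_of_nonneg (by positivity)
    (by norm_num), ← ENNReal.mul_rpow_of_nonneg _ _ (by norm_num), ← hconst]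
  gcongr
  exact lintegral_squareFun_block_rpow_le θ hh hbg hA hr hrR hw

end SquareFunctionEstimate

end RadialBlocks

end

open RadialBlocks in
theorem lemma5p1_general {ε₀ : ℝ} {φ : SpaceTime → Plane → ℝ} (hφ : IsPhase φ ε₀)
    {a₂ : Plane → ℂ} (ha₂ : Continuous a₂) (ha₂c : HasCompactSupport a₂)
    (ha₂s : tsupport a₂ ⊆ Metric.ball e₂ ε₀) (ρ : 𝓢(Plane, ℝ)) (N : ℕ) {A : ℝ} (hA : 0 < A)
    {ε : ℝ} (hε : 0 ≤ ε) :
    ∃ C : ℝ, ∀ lam : ℝ, 1 ≤ lam →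
      ∀ {ι : Type} [Countable ι] {χ : ι → Plane → ℝ},
        (∀ ν, ContinuousOn (χ ν) (Metric.ball e₂ ε₀)) →
      ∀ zc : SpaceTime, lam⁻¹ • zc ∈ stBall ε₀ →
      ∀ w : SpaceTime → ℝ, IsAdaptedWeight w (lam ^ (1 / 2 - ε)) N A →
      ∀ g : Plane → ℂ, LocallyIntegrable g →
        weightedNorm w (squareFun fun i : ι × (Fin 2 → ℤ) =>
            extBlock φ ε₀ lam ε zc a₂ ρ (χ i.1) i.2 g) ≤
          ENNReal.ofReal (C * lam ^ (3 / 20 * (N : ℝ) * ε)) *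
            weightedNorm w (squareFun fun ν => extAngular φ ε₀ lam zc a₂ (χ ν) g) := by
  let θ : 𝓢(Plane, ℂ) := SchwartzMap.postcompCLM Complex.ofRealCLM ρ
  obtain ⟨C, hC⟩ := exists_weightedNorm_squareFun_block_le θ N hA
  refine ⟨C, fun lam hlam ι _ χ hχ zc hzc w hw g hg => ?_⟩
  have hlam0 : 0 < lam := zero_lt_one.trans_le hlam
  let b (ν : ι) : Plane → ℂ := ampAngular φ ε₀ lam zc a₂ (χ ν)
  obtain ⟨h, hh, hφh⟩ := hφ.exists_measurable_eqOn_hFun hzc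
  have hb (ν : ι) (η : Plane) (hne : b ν η ≠ 0) : hFun φ ε₀ lam zc η = h η :=
    hφh (mem_gradImage_of_transported_ne_zero hne)
  have hang (ν : ι) : extAngular φ ε₀ lam zc a₂ (χ ν) g = extension h (b ν) g :=
    extension_congr (hb ν) g
  have hblk (i : ι × (Fin 2 → ℤ)) : extBlock φ ε₀ lam ε zc a₂ ρ (χ i.1) i.2 g =
      extension h (fun η => θ (lam ^ (1 / 2 - ε / 2) • η - latticePt i.2) * b i.1 η) g :=
    extension_congr (fun η hne => hb i.1 η (right_ne_zero_of_mul hne)) g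
  have hratio : (lam ^ (1 / 2 - ε / 2) / lam ^ (1 / 2 - ε)) ^ (3 / 10 * N : ℝ) =
      lam ^ (3 / 20 * (N : ℝ) * ε) := by
    rw [← Real.rpow_sub hlam0, ← Real.rpow_mul hlam0.le]
    ring_nf
  simp only [hang, hblk, ← hratio]
  exact hC hh (fun ν => hφ.integrable_ampAngular_mul hzc ha₂ ha₂c ha₂s (hχ ν) hg)
    (by positivity) (Real.rpow_le_rpow_of_exponent_le hlam (by linarith)) hw

open RadialBlocks in
theorem lemma5p1
    (ε₀ : ℝ) (hε₀ : 0 < ε₀) (hε₀' : ε₀ < 1)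
    (φ : RadialBlocks.SpaceTime → RadialBlocks.Plane → ℝ) (hφ : RadialBlocks.IsPhase φ ε₀)
    (a₂ : RadialBlocks.Plane → ℂ) (ha₂ : ContDiff ℝ ∞ a₂) (ha₂c : HasCompactSupport a₂)
    (ha₂s : tsupport a₂ ⊆ Metric.ball RadialBlocks.e₂ ε₀)
    (ρ : RadialBlocks.Plane → ℝ) (hρ : RadialBlocks.IsLatticePartition ρ)
    (K : ℝ) (Cχ : ℕ → ℝ) (N : ℕ) (A : ℝ) (hA : 1 ≤ A) (ε : ℝ) (hε : 0 < ε) :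
    ∃ (C : ℝ) (rapDec : ℝ → ℝ), RadialBlocks.IsRapDec rapDec ∧
      ∀ lam : ℝ, 1 ≤ lam →
      ∀ (n : ℕ) (κ : Fin (n + 1) → RadialBlocks.Plane)
        (χ : Fin (n + 1) → RadialBlocks.Plane → ℝ),
        RadialBlocks.IsAngularPartition lam K Cχ n κ χ →
      ∀ zc : RadialBlocks.SpaceTime, lam⁻¹ • zc ∈ RadialBlocks.stBall ε₀ →
      ∀ w : RadialBlocks.SpaceTime → ℝ,
        RadialBlocks.IsAdaptedWeight w (lam ^ (1 / 2 - ε)) N A →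
      ∀ g : RadialBlocks.Plane → ℂ, MemLp g (10 / 3) volume →
        RadialBlocks.weightedNorm w (RadialBlocks.squareFun
            (fun i : Fin (n + 1) × (Fin 2 → ℤ) =>
              RadialBlocks.extBlock φ ε₀ lam ε zc a₂ ρ (χ i.1) i.2 g))
          ≤ ENNReal.ofReal (C * lam ^ (3 / 20 * (N : ℝ) * ε)) *
              RadialBlocks.weightedNorm w (RadialBlocks.squareFun
                (fun ν : Fin (n + 1) => RadialBlocks.extAngular φ ε₀ lam zc a₂ (χ ν) g))
            + ENNReal.ofReal (rapDec lam) * eLpNorm g (10 / 3) volume := by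
  obtain ⟨C, hC⟩ := lemma5p1_general hφ ha₂.continuous ha₂c ha₂s
    (hρ.compact.toSchwartzMap hρ.smooth) N (zero_lt_one.trans_le hA) hε.le
  refine ⟨C, 0, fun _ => ⟨0, fun _ _ => by simp⟩, fun lam hlam n κ χ hχ zc hzc w hw g hg => ?_⟩
  have hball : Metric.ball e₂ ε₀ ⊆ {0}ᶜ :=
    subset_compl_singleton_iff.2 (zero_notMem_ball hε₀'.le)
  have hp : (1 : ℝ≥0∞) ≤ 10 / 3 := by
    rw [ENNReal.le_div_iff_mul_le (by simp) (by simp)]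
    norm_num
  exact (hC lam hlam (fun ν => (hχ.smooth ν).continuousOn.mono hball) zc hzc w hw g
    (hg.locallyIntegrable hp)).trans le_self_add
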